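/- Let $R$ be an associative ring with identity and let $n\ge 1$. A left $R$-module $M$ is called $n$-strongly Gorenstein flat ($n$-SG-flat) if there is an exact sequence of left $R$-modules $$0\to M\to F_{n-1}\to\cdots\to F_1\to F_0\to M\to 0$$ with all $F_i$ flat that remains exact after applying $I\otimes_R-$ for every injective right $R$-module $I$. (1) Let $M$ be a left $R$-module and let $\widetilde M$ be a part of $M$ without flat direct summands, that is, a submodule of $M$ such that $M=\widetilde M\oplus F$ for some flat submodule $F$ and $\widetilde M$ has no nonzero flat direct summand. Then $M$ is $n$-SG-flat if and only if $\widetilde M$ is $n$-SG-flat. (2) Let $M$ and $N$ be flatly equivalent left $R$-modules, that is, $M\oplus F_1\cong N\oplus F_2$ for some flat left $R$-modules $F_1,F_2$. Then $M$ is $n$-SG-flat if and only if $N$ is $n$-SG-flat. -/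

import Mathlib

universe u

open scoped TensorProduct

noncomputable section

namespace SGFlat

/-- The subgroup of `A ⊗[ℤ] M` generated by all elements `(a r) ⊗ m - a ⊗ (r m)`, for a right
`R`-module `A` (a module over `Rᵐᵒᵖ`, the right action being `a r = MulOpposite.op r • a`) and a
left `R`-module `M`. -/
def balancedRel (R : Type u) [Ring R] (A M : Type u) [AddCommGroup A] [Module Rᵐᵒᵖ A]
    [AddCommGroup M] [Module R M] : AddSubgroup (A ⊗[ℤ] M) :=
  AddSubgroup.closure
    {x | ∃ (a : A) (r : R) (m : M), x = (MulOpposite.op r • a) ⊗ₜ[ℤ] m - a ⊗ₜ[ℤ] (r • m)}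

/-- The abelian group `A ⊗_R M`, the tensor product of a right module and a left module over a
not necessarily commutative ring `R`. -/
abbrev BTensor (R : Type u) [Ring R] (A M : Type u) [AddCommGroup A] [Module Rᵐᵒᵖ A]
    [AddCommGroup M] [Module R M] : Type u :=
  (A ⊗[ℤ] M) ⧸ balancedRel R A M

/-- The homomorphism `f ⊗ g : A ⊗[ℤ] M → B ⊗[ℤ] N`. -/
def preMap {R : Type u} [Ring R] {A B M N : Type u}
    [AddCommGroup A] [Module Rᵐᵒᵖ A] [AddCommGroup B] [Module Rᵐᵒᵖ B]
    [AddCommGroup M] [Module R M] [AddCommGroup N] [Module R N]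
    (f : A →ₗ[Rᵐᵒᵖ] B) (g : M →ₗ[R] N) : A ⊗[ℤ] M →+ B ⊗[ℤ] N :=
  (TensorProduct.map f.toAddMonoidHom.toIntLinearMap g.toAddMonoidHom.toIntLinearMap).toAddMonoidHom

theorem balancedRel_le_comap {R : Type u} [Ring R] {A B M N : Type u}
    [AddCommGroup A] [Module Rᵐᵒᵖ A] [AddCommGroup B] [Module Rᵐᵒᵖ B]
    [AddCommGroup M] [Module R M] [AddCommGroup N] [Module R N]
    (f : A →ₗ[Rᵐᵒᵖ] B) (g : M →ₗ[R] N) :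
    balancedRel R A M ≤ (balancedRel R B N).comap (preMap f g) := by
  refine (AddSubgroup.closure_le _).2 ?_
  rintro _ ⟨a, r, m, rfl⟩
  refine AddSubgroup.subset_closure ⟨f a, r, g m, ?_⟩
  simp [preMap]

/-- The homomorphism `f ⊗_R g : A ⊗_R M → B ⊗_R N`. -/
def BTensor.map {R : Type u} [Ring R] {A B M N : Type u}
    [AddCommGroup A] [Module Rᵐᵒᵖ A] [AddCommGroup B] [Module Rᵐᵒᵖ B]
    [AddCommGroup M] [Module R M] [AddCommGroup N] [Module R N]
    (f : A →ₗ[Rᵐᵒᵖ] B) (g : M →ₗ[R] N) : BTensor R A M →+ BTensor R B N :=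
  QuotientAddGroup.map _ _ (preMap f g) (balancedRel_le_comap f g)

/-- A left `R`-module `M` is flat: `- ⊗_R M` preserves injectivity of homomorphisms of right
`R`-modules. -/
def IsFlat (R : Type u) [Ring R] (M : Type u) [AddCommGroup M] [Module R M] : Prop :=
  ∀ (A B : Type u) [AddCommGroup A] [Module Rᵐᵒᵖ A] [AddCommGroup B] [Module Rᵐᵒᵖ B]
    (f : A →ₗ[Rᵐᵒᵖ] B), Function.Injective f →
      Function.Injective (BTensor.map f (LinearMap.id : M →ₗ[R] M))

/-- Exactness of the sequence of abelian groups
`0 → X (n+1) → X n → ⋯ → X 1 → X 0 → 0` with maps `d i : X (i+1) → X i` for `0 ≤ i ≤ n`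
(the terms `X i` with `i > n + 1` and the maps `d i` with `i > n` play no role). -/
def IsExactSeq (n : ℕ) (X : ℕ → Type u) [∀ i, AddCommGroup (X i)]
    (d : ∀ i, X (i + 1) →+ X i) : Prop :=
  Function.Injective (d n) ∧ (∀ i < n, Function.Exact (d (i + 1)) (d i)) ∧
    Function.Surjective (d 0)

/-- A left `R`-module `M` is `n`-strongly Gorenstein flat (for `n ≥ 1`): there is an exact sequence
`0 → M → F_{n-1} → ⋯ → F_0 → M → 0` of left `R`-modules, with every `F_i` flat, which stays exact
under `I ⊗_R -` for every injective right `R`-module `I`. Here `F_i` is `X (i + 1)`, and both end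
terms `X 0` and `X (n + 1)` are identified with `M`. -/
def IsNSGFlat (R : Type u) [Ring R] (n : ℕ) (M : Type u) [AddCommGroup M] [Module R M] : Prop :=
  ∃ (X : ℕ → ModuleCat.{u} R) (d : ∀ i, X (i + 1) →ₗ[R] X i),
    Nonempty (X 0 ≃ₗ[R] M) ∧ Nonempty (X (n + 1) ≃ₗ[R] M) ∧
    (∀ i < n, IsFlat R (X (i + 1))) ∧
    IsExactSeq n (fun i => X i) (fun i => (d i).toAddMonoidHom) ∧
    ∀ (I : Type u) [AddCommGroup I] [Module Rᵐᵒᵖ I], Module.Injective Rᵐᵒᵖ I →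
      IsExactSeq n (fun i => BTensor R I (X i))
        (fun i => BTensor.map (LinearMap.id : I →ₗ[Rᵐᵒᵖ] I) (d i))

/-- `M` has no nonzero flat direct summand. -/
def HasNoFlatSummand (R : Type u) [Ring R] (M : Type u) [AddCommGroup M] [Module R M] : Prop :=
  ∀ P Q : Submodule R M, IsCompl P Q → IsFlat R P → P = ⊥

/-- `N` is a part of `M` without flat direct summands (the module written `M̃`): `M = N ⊕ F` for
some flat submodule `F`, and `N` has no nonzero flat direct summand. -/
def IsFlatFreePart {R : Type u} [Ring R] {M : Type u} [AddCommGroup M] [Module R M]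
    (N : Submodule R M) : Prop :=
  (∃ F : Submodule R M, IsCompl N F ∧ IsFlat R F) ∧ HasNoFlatSummand R N

/-- `M` and `N` are flatly equivalent: `M ⊕ F₁ ≅ N ⊕ F₂` for some flat modules `F₁`, `F₂`. -/
def FlatlyEquivalent (R : Type u) [Ring R] (M N : Type u) [AddCommGroup M] [Module R M]
    [AddCommGroup N] [Module R N] : Prop :=
  ∃ F₁ F₂ : ModuleCat.{u} R, IsFlat R F₁ ∧ IsFlat R F₂ ∧ Nonempty ((M × F₁) ≃ₗ[R] (N × F₂))

end SGFlat

end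

open scoped TensorProduct

noncomputable section

namespace SGFlat

open Function

/-! Both statements reduce to one fact: for flat `F`, `A × F` is n-SG-flat iff `A` is
(`isNSGFlat_prod_iff`). To add `F`, take the direct sum with the contractible sequence `0 → F → F² →
⋯ → F² → F → 0`, which stays exact under every `I ⊗_R -`. To cancel `F`, the two ends are treated
separately; `HasFlatSeq` therefore allows distinct end modules. On the left, divide the two leftmost
terms by `F`. The term next to the end stays flat because `F` is pure in it: exactness under `I ⊗_R
-` gives injectivity for injective `I`, and flatness of `F` with an embedding of an arbitrary module
into an injective one gives the rest. On the right, replace the two rightmost terms by the kernels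
of their maps onto `F`. The new term is flat as a kernel of an epimorphism of flat modules, and
tensoring is harmless because sequences with flat cokernel are pure. -/

/-- If `g y` lies in `U`, then `hU` corrects `y` by an element of `T` so that it lies in `ker g`.
This carries right exactness from `⊗[ℤ]` to `⊗_R`. -/
theorem exact_quotientAddGroup_map {G H K : Type*} [AddCommGroup G] [AddCommGroup H]
    [AddCommGroup K] {S : AddSubgroup G} {T : AddSubgroup H} {U : AddSubgroup K}
    {f : G →+ H} {g : H →+ K} (hST : S ≤ T.comap f) (hTU : T ≤ U.comap g)
    (hU : U ≤ T.map g) (h : Exact f g) :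
    Exact (QuotientAddGroup.map S T f hST) (QuotientAddGroup.map T U g hTU) := by
  intro y
  induction y using QuotientAddGroup.induction_on with
  | H y =>
  constructor
  · intro hy
    rw [QuotientAddGroup.map_mk, QuotientAddGroup.eq_zero_iff] at hy
    obtain ⟨t, ht, hty⟩ := hU hy
    obtain ⟨x, hx⟩ := (h (y - t)).1 (by rw [map_sub, hty, sub_self])
    refine ⟨(x : G ⧸ S), ?_⟩
    rw [QuotientAddGroup.map_mk, hx, QuotientAddGroup.mk_sub,
      (QuotientAddGroup.eq_zero_iff t).2 ht, sub_zero]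
  · rintro ⟨x, hx⟩
    induction x using QuotientAddGroup.induction_on with
    | H x =>
    rw [← hx, QuotientAddGroup.map_mk, QuotientAddGroup.map_mk, h.apply_apply_eq_zero]
    rfl

/-! ### Functoriality and right exactness of the balanced tensor product. -/

section BTensor

variable {R : Type u} [Ring R] {A B C : Type u} [AddCommGroup A] [Module Rᵐᵒᵖ A]
  [AddCommGroup B] [Module Rᵐᵒᵖ B] [AddCommGroup C] [Module Rᵐᵒᵖ C]
  {M N P : Type u} [AddCommGroup M] [Module R M] [AddCommGroup N] [Module R N]
  [AddCommGroup P] [Module R P]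

/-- The pure tensor `a ⊗ m` in `A ⊗_R M`. -/
def BTensor.tmul (a : A) (m : M) : BTensor R A M := QuotientAddGroup.mk (a ⊗ₜ[ℤ] m)

@[simp] theorem BTensor.map_tmul (f : A →ₗ[Rᵐᵒᵖ] B) (g : M →ₗ[R] N) (a : A) (m : M) :
    BTensor.map f g (BTensor.tmul a m) = BTensor.tmul (f a) (g m) := rfl

theorem BTensor.tmul_add (a : A) (m m' : M) :
    (BTensor.tmul a (m + m') : BTensor R A M) = BTensor.tmul a m + BTensor.tmul a m' := by
  simp only [BTensor.tmul, TensorProduct.tmul_add]; rfl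

theorem BTensor.add_tmul (a a' : A) (m : M) :
    (BTensor.tmul (a + a') m : BTensor R A M) = BTensor.tmul a m + BTensor.tmul a' m := by
  simp only [BTensor.tmul, TensorProduct.add_tmul]; rfl

theorem BTensor.smul_tmul (r : R) (a : A) (m : M) :
    (BTensor.tmul (MulOpposite.op r • a) m : BTensor R A M) = BTensor.tmul a (r • m) := by
  rw [← sub_eq_zero]
  exact (QuotientAddGroup.eq_zero_iff _).2 (AddSubgroup.subset_closure ⟨a, r, m, rfl⟩)

theorem BTensor.hom_ext {G : Type*} [AddCommGroup G] {f g : BTensor R A M →+ G}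
    (h : ∀ a m, f (BTensor.tmul a m) = g (BTensor.tmul a m)) : f = g := by
  refine DFunLike.ext _ _ fun y => ?_
  obtain ⟨x, rfl⟩ := QuotientAddGroup.mk_surjective y
  induction x using TensorProduct.induction_on with
  | zero => exact (map_zero f).trans (map_zero g).symm
  | tmul a m => exact h a m
  | add x y hx hy =>
    rw [QuotientAddGroup.mk_add, map_add, map_add, hx, hy]

/-- The homomorphism out of `A ⊗_R M` induced by a balanced biadditive map. -/
def BTensor.lift {G : Type u} [AddCommGroup G] (f : A →+ M →+ G)
    (hf : ∀ (a : A) (r : R) (m : M), f (MulOpposite.op r • a) m = f a (r • m)) :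
    BTensor R A M →+ G :=
  QuotientAddGroup.lift _ (TensorProduct.liftAddHom f (fun n a m => by simp))
    ((AddSubgroup.closure_le _).2 (by
      rintro _ ⟨a, r, m, rfl⟩
      simp [hf]))

@[simp] theorem BTensor.lift_tmul {G : Type u} [AddCommGroup G] (f : A →+ M →+ G)
    (hf : ∀ (a : A) (r : R) (m : M), f (MulOpposite.op r • a) m = f a (r • m)) (a : A) (m : M) :
    BTensor.lift f hf (BTensor.tmul a m) = f a m := rfl

theorem BTensor.map_map (f : A →ₗ[Rᵐᵒᵖ] B) (f' : B →ₗ[Rᵐᵒᵖ] C) (g : M →ₗ[R] N)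
    (g' : N →ₗ[R] P) (x : BTensor R A M) :
    BTensor.map f' g' (BTensor.map f g x) = BTensor.map (f' ∘ₗ f) (g' ∘ₗ g) x :=
  DFunLike.congr_fun (f := (BTensor.map f' g').comp (BTensor.map f g))
    (g := BTensor.map (f' ∘ₗ f) (g' ∘ₗ g))
    (BTensor.hom_ext fun _ _ => rfl) x

theorem BTensor.map_id_map_id (g : M →ₗ[R] N) (g' : N →ₗ[R] P) (x : BTensor R A M) :
    BTensor.map (LinearMap.id : A →ₗ[Rᵐᵒᵖ] A) g' (BTensor.map LinearMap.id g x) =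
      BTensor.map LinearMap.id (g' ∘ₗ g) x :=
  BTensor.map_map _ _ _ _ _

theorem BTensor.map_comm (f : A →ₗ[Rᵐᵒᵖ] B) (g : M →ₗ[R] N) (x : BTensor R A M) :
    BTensor.map f LinearMap.id (BTensor.map LinearMap.id g x) =
      BTensor.map LinearMap.id g (BTensor.map f LinearMap.id x) := by
  simp only [BTensor.map_map, LinearMap.id_comp, LinearMap.comp_id]

@[simp] theorem BTensor.map_id_id (x : BTensor R A M) :
    BTensor.map (LinearMap.id : A →ₗ[Rᵐᵒᵖ] A) (LinearMap.id : M →ₗ[R] M) x = x :=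
  DFunLike.congr_fun (f := BTensor.map LinearMap.id LinearMap.id) (g := AddMonoidHom.id _)
    (BTensor.hom_ext fun _ _ => rfl) x

theorem BTensor.map_add_right (f : A →ₗ[Rᵐᵒᵖ] B) (g g' : M →ₗ[R] N) (x : BTensor R A M) :
    BTensor.map f (g + g') x = BTensor.map f g x + BTensor.map f g' x :=
  DFunLike.congr_fun (f := BTensor.map f (g + g')) (g := BTensor.map f g + BTensor.map f g')
    (BTensor.hom_ext fun _ _ => by simp [BTensor.tmul_add]) x

@[simp] theorem BTensor.map_zero_right (f : A →ₗ[Rᵐᵒᵖ] B) (x : BTensor R A M) :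
    BTensor.map f (0 : M →ₗ[R] N) x = 0 := by
  have h := BTensor.map_add_right f (0 : M →ₗ[R] N) 0 x
  rwa [add_zero, left_eq_add] at h

theorem BTensor.map_surjective {f : A →ₗ[Rᵐᵒᵖ] B} {g : M →ₗ[R] N} (hf : Surjective f)
    (hg : Surjective g) : Surjective (BTensor.map f g) := by
  intro y
  obtain ⟨y, rfl⟩ := QuotientAddGroup.mk_surjective y
  obtain ⟨x, rfl⟩ := TensorProduct.map_surjective (g := f.toAddMonoidHom.toIntLinearMap)
    (g' := g.toAddMonoidHom.toIntLinearMap) hf hg y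
  exact ⟨QuotientAddGroup.mk x, rfl⟩

theorem balancedRel_le_map {f : A →ₗ[Rᵐᵒᵖ] B} {g : M →ₗ[R] N} (hf : Surjective f)
    (hg : Surjective g) : balancedRel R B N ≤ (balancedRel R A M).map (preMap f g) := by
  refine (AddSubgroup.closure_le _).2 ?_
  rintro _ ⟨b, r, n, rfl⟩
  obtain ⟨a, rfl⟩ := hf b
  obtain ⟨m, rfl⟩ := hg n
  exact ⟨_, AddSubgroup.subset_closure ⟨a, r, m, rfl⟩, by simp [preMap]⟩

/-- Right exactness over `ℤ` descends to the quotients because a surjection lifts every balancing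
relation. -/
theorem BTensor.exact_map_right {g : M →ₗ[R] N} {h : N →ₗ[R] P} (hgh : Exact g h)
    (hh : Surjective h) :
    Exact (BTensor.map (LinearMap.id : A →ₗ[Rᵐᵒᵖ] A) g) (BTensor.map LinearMap.id h) :=
  exact_quotientAddGroup_map _ _ (balancedRel_le_map surjective_id hh)
    (lTensor_exact A (f := g.toAddMonoidHom.toIntLinearMap)
      (g := h.toAddMonoidHom.toIntLinearMap) hgh hh)

theorem BTensor.exact_map_left {f : A →ₗ[Rᵐᵒᵖ] B} {g : B →ₗ[Rᵐᵒᵖ] C} (hfg : Exact f g)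
    (hg : Surjective g) :
    Exact (BTensor.map f (LinearMap.id : M →ₗ[R] M)) (BTensor.map g LinearMap.id) :=
  exact_quotientAddGroup_map _ _ (balancedRel_le_map hg surjective_id)
    (rTensor_exact M (f := f.toAddMonoidHom.toIntLinearMap)
      (g := g.toAddMonoidHom.toIntLinearMap) hfg hg)

theorem BTensor.map_injective_of_retraction {g : M →ₗ[R] N} {p : N →ₗ[R] M}
    (h : p ∘ₗ g = LinearMap.id) :
    Injective (BTensor.map (LinearMap.id : A →ₗ[Rᵐᵒᵖ] A) g) :=
  LeftInverse.injective (g := BTensor.map LinearMap.id p) fun x => by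
    rw [BTensor.map_id_map_id, h, BTensor.map_id_id]

end BTensor

/-! ### Tensoring with free right modules. -/

section Free

variable {R : Type u} [Ring R] {ι : Type u} {M N : Type u} [AddCommGroup M] [Module R M]
  [AddCommGroup N] [Module R N]

/-- The homomorphism `R^(ι) ⊗_R M → M^(ι)`. -/
def freeTensorToFinsupp (R : Type u) [Ring R] (ι M : Type u) [AddCommGroup M] [Module R M] :
    BTensor R (ι →₀ Rᵐᵒᵖ) M →+ (ι →₀ M) :=
  BTensor.lift
    (Finsupp.liftAddHom fun i => AddMonoidHom.mk' (fun s : Rᵐᵒᵖ =>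
        (Finsupp.singleAddHom i).comp (DistribSMul.toAddMonoidHom M s.unop)) (by
      intro s t
      ext m : 1
      simp [add_smul]))
    (by
      intro a r m
      induction a using Finsupp.induction_linear with
      | zero => simp
      | add a b ha hb => rw [smul_add, map_add, map_add, AddMonoidHom.add_apply, ha, hb]; rfl
      | single i s => simp [mul_smul, -Finsupp.single_mul])

theorem freeTensorToFinsupp_single (i : ι) (s : Rᵐᵒᵖ) (m : M) :
    freeTensorToFinsupp R ι M (BTensor.tmul (Finsupp.single i s) m) =
      Finsupp.single i (s.unop • m) := by
  simp [freeTensorToFinsupp]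

/-- A left inverse sends `m` in coordinate `i` to `e_i ⊗ m`; balancing moves the scalar across. -/
theorem freeTensorToFinsupp_injective : Injective (freeTensorToFinsupp R ι M) := by
  let ψ : (ι →₀ M) →+ BTensor R (ι →₀ Rᵐᵒᵖ) M := Finsupp.liftAddHom fun i =>
    AddMonoidHom.mk' (fun m => BTensor.tmul (Finsupp.single i 1) m) (BTensor.tmul_add _)
  have h : ψ.comp (freeTensorToFinsupp R ι M) = AddMonoidHom.id _ := by
    refine BTensor.hom_ext fun a m => ?_
    induction a using Finsupp.induction_linear with
    | zero =>
      have h0 : (BTensor.tmul 0 m : BTensor R (ι →₀ Rᵐᵒᵖ) M) = 0 := by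
        simp only [BTensor.tmul, TensorProduct.zero_tmul]; rfl
      rw [h0, map_zero, map_zero]
    | add a b ha hb => rw [BTensor.add_tmul, map_add, map_add, ha, hb]
    | single i s =>
      rw [AddMonoidHom.comp_apply, freeTensorToFinsupp_single]
      simp only [ψ, Finsupp.liftAddHom_apply_single, AddMonoidHom.mk'_apply,
        AddMonoidHom.id_apply]
      rw [← BTensor.smul_tmul]
      simp
  exact LeftInverse.injective (g := ψ) fun x => DFunLike.congr_fun h x

/-- Inside `M^(ι)` and `N^(ι)` the map becomes `g` in each coordinate. -/
theorem BTensor.map_injective_of_free {g : M →ₗ[R] N} (hg : Injective g) :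
    Injective (BTensor.map (LinearMap.id : (ι →₀ Rᵐᵒᵖ) →ₗ[Rᵐᵒᵖ] (ι →₀ Rᵐᵒᵖ)) g) := by
  have h : (freeTensorToFinsupp R ι N).comp (BTensor.map LinearMap.id g) =
      (Finsupp.mapRange.addMonoidHom g.toAddMonoidHom).comp (freeTensorToFinsupp R ι M) := by
    refine BTensor.hom_ext fun a m => ?_
    simp only [AddMonoidHom.comp_apply, BTensor.map_tmul, LinearMap.id_apply]
    induction a using Finsupp.induction_linear with
    | zero => simp [freeTensorToFinsupp]
    | add a b ha hb => simp only [BTensor.add_tmul, map_add, ha, hb]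
    | single i s => simp [freeTensorToFinsupp_single]
  have h2 : Injective ((freeTensorToFinsupp R ι N).comp (BTensor.map LinearMap.id g)) := by
    rw [h]
    exact (Finsupp.mapRange_injective g (map_zero g) hg).comp freeTensorToFinsupp_injective
  exact Injective.of_comp h2

end Free

/-! ### Flatness and purity, by diagram chases in place of Tor. -/

section Flat

variable {R : Type u} [Ring R] {M N P : Type u} [AddCommGroup M] [Module R M]
  [AddCommGroup N] [Module R N] [AddCommGroup P] [Module R P]

theorem IsFlat.of_retract (h : IsFlat R M) (i : N →ₗ[R] M) (p : M →ₗ[R] N)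
    (hpi : p ∘ₗ i = LinearMap.id) : IsFlat R N := by
  intro A B _ _ _ _ f hf
  have h2 : Injective (BTensor.map f LinearMap.id ∘
      BTensor.map (LinearMap.id : A →ₗ[Rᵐᵒᵖ] A) i) :=
    (h A B f hf).comp (BTensor.map_injective_of_retraction hpi)
  have h3 : BTensor.map f LinearMap.id ∘ BTensor.map (LinearMap.id : A →ₗ[Rᵐᵒᵖ] A) i =
      BTensor.map LinearMap.id i ∘ BTensor.map f LinearMap.id :=
    funext fun x => BTensor.map_comm f i x
  rw [h3] at h2
  exact h2.of_comp

theorem IsFlat.of_equiv (h : IsFlat R M) (e : M ≃ₗ[R] N) : IsFlat R N :=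
  h.of_retract e.symm e (by ext; simp)

theorem IsFlat.prod (hM : IsFlat R M) (hN : IsFlat R N) : IsFlat R (M × N) := by
  intro A B _ _ _ _ f hf
  refine (injective_iff_map_eq_zero _).2 fun x hx => ?_
  have h1 : BTensor.map LinearMap.id (LinearMap.fst R M N) x = 0 := by
    refine (injective_iff_map_eq_zero _).1 (hM A B f hf) _ ?_
    rw [BTensor.map_comm, hx, map_zero]
  have h2 : BTensor.map LinearMap.id (LinearMap.snd R M N) x = 0 := by
    refine (injective_iff_map_eq_zero _).1 (hN A B f hf) _ ?_
    rw [BTensor.map_comm, hx, map_zero]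
  have h3 : LinearMap.inl R M N ∘ₗ LinearMap.fst R M N +
      LinearMap.inr R M N ∘ₗ LinearMap.snd R M N = LinearMap.id := by
    ext <;> simp
  rw [← BTensor.map_id_id x, ← h3, BTensor.map_add_right, ← BTensor.map_id_map_id,
    ← BTensor.map_id_map_id, h1, h2, map_zero, map_zero, add_zero]

/-- Lift an element killed in `A ⊗ N` to `p` in `Q ⊗ M`. Its image in `Q ⊗ N` comes from `L ⊗ N`,
with `L = ker π`, and dies in `Q ⊗ P`, hence already in `L ⊗ P` by flatness. So it comes from `L ⊗
M`; injectivity on `Q` puts `p` in the image of `L ⊗ M`, which vanishes in `A ⊗ M`. -/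
theorem IsFlat.map_injective_of_surjective (hP : IsFlat R P) {g : M →ₗ[R] N} {h : N →ₗ[R] P}
    (hgh : Exact g h) (hh : Surjective h) {Q A : Type u} [AddCommGroup Q] [Module Rᵐᵒᵖ Q]
    [AddCommGroup A] [Module Rᵐᵒᵖ A] {π : Q →ₗ[Rᵐᵒᵖ] A} (hπ : Surjective π)
    (hQ : Injective (BTensor.map (LinearMap.id : Q →ₗ[Rᵐᵒᵖ] Q) g)) :
    Injective (BTensor.map (LinearMap.id : A →ₗ[Rᵐᵒᵖ] A) g) := by
  let L := LinearMap.ker π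
  have hL : Exact L.subtype π := LinearMap.exact_subtype_ker_map π
  refine (injective_iff_map_eq_zero _).2 fun x hx => ?_
  obtain ⟨p, rfl⟩ := BTensor.map_surjective (g := (LinearMap.id : M →ₗ[R] M)) hπ surjective_id x
  rw [← BTensor.map_comm] at hx
  obtain ⟨l, hl⟩ := (BTensor.exact_map_left hL hπ _).1 hx
  have h0 : BTensor.map LinearMap.id h l = 0 := by
    refine (injective_iff_map_eq_zero _).1 (hP _ _ L.subtype L.subtype_injective) _ ?_
    rw [BTensor.map_comm, hl, (BTensor.exact_map_right hgh hh).apply_apply_eq_zero]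
  obtain ⟨k, rfl⟩ := (BTensor.exact_map_right hgh hh _).1 h0
  rw [BTensor.map_comm] at hl
  rw [← hQ hl, (BTensor.exact_map_left hL hπ).apply_apply_eq_zero]

/-- A short exact sequence with flat cokernel is pure. -/
theorem IsFlat.map_injective (hP : IsFlat R P) {g : M →ₗ[R] N} {h : N →ₗ[R] P}
    (hg : Injective g) (hgh : Exact g h) (hh : Surjective h)
    (A : Type u) [AddCommGroup A] [Module Rᵐᵒᵖ A] :
    Injective (BTensor.map (LinearMap.id : A →ₗ[Rᵐᵒᵖ] A) g) :=
  hP.map_injective_of_surjective hgh hh (π := Finsupp.linearCombination Rᵐᵒᵖ (id : A → A))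
    (Finsupp.linearCombination_id_surjective _ _) (BTensor.map_injective_of_free hg)

/-- The kernel of an epimorphism of flat modules is flat. -/
theorem IsFlat.kernel (hN : IsFlat R N) (hP : IsFlat R P) {g : M →ₗ[R] N} {h : N →ₗ[R] P}
    (hg : Injective g) (hgh : Exact g h) (hh : Surjective h) : IsFlat R M := by
  intro A B _ _ _ _ f hf
  have h1 : Injective (BTensor.map f LinearMap.id ∘
      BTensor.map (LinearMap.id : A →ₗ[Rᵐᵒᵖ] A) g) :=
    (hN A B f hf).comp (hP.map_injective hg hgh hh A)
  have h2 : BTensor.map f LinearMap.id ∘ BTensor.map (LinearMap.id : A →ₗ[Rᵐᵒᵖ] A) g =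
      BTensor.map LinearMap.id g ∘ BTensor.map f LinearMap.id :=
    funext fun x => BTensor.map_comm f g x
  rw [h2] at h1
  exact h1.of_comp

/-- The cokernel of a pure monomorphism into a flat module is flat. -/
theorem IsFlat.cokernel (hN : IsFlat R N) {g : M →ₗ[R] N} {h : N →ₗ[R] P}
    (hg : ∀ (A : Type u) [AddCommGroup A] [Module Rᵐᵒᵖ A],
      Injective (BTensor.map (LinearMap.id : A →ₗ[Rᵐᵒᵖ] A) g))
    (hgh : Exact g h) (hh : Surjective h) : IsFlat R P := by
  intro A B _ _ _ _ f hf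
  -- The chase uses purity for the module `B / f(A)`: the element of `B ⊗ M` found below dies in `(B
  -- / f(A)) ⊗ M`, so it comes from `A ⊗ M`.
  let q := (LinearMap.range f).mkQ
  have hq : Surjective q := Submodule.mkQ_surjective _
  have hfq : Exact f q := LinearMap.exact_map_mkQ_range f
  refine (injective_iff_map_eq_zero _).2 fun x hx => ?_
  obtain ⟨y, rfl⟩ := BTensor.map_surjective (f := (LinearMap.id : A →ₗ[Rᵐᵒᵖ] A)) surjective_id hh x
  rw [BTensor.map_comm] at hx
  obtain ⟨s, hs⟩ := (BTensor.exact_map_right hgh hh _).1 hx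
  have h0 : BTensor.map q LinearMap.id s = 0 := by
    refine (injective_iff_map_eq_zero _).1 (hg _) _ ?_
    rw [← BTensor.map_comm, hs, (BTensor.exact_map_left hfq hq).apply_apply_eq_zero]
  obtain ⟨t, rfl⟩ := (BTensor.exact_map_left hfq hq _).1 h0
  rw [← BTensor.map_comm] at hs
  rw [← hN A B f hf hs, (BTensor.exact_map_right hgh hh).apply_apply_eq_zero]

theorem exists_injective_embedding (S : Type u) [Ring S] (A : Type u) [AddCommGroup A]
    [Module S A] : ∃ (I : ModuleCat.{u} S) (f : A →ₗ[S] I), Module.Injective S I ∧ Injective f := by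
  obtain ⟨⟨J, _, f, _⟩⟩ := CategoryTheory.EnoughInjectives.presentation (ModuleCat.of S A)
  exact ⟨J, f.hom, Module.injective_module_of_injective_object S J,
    (ModuleCat.mono_iff_injective f).1 inferInstance⟩

/-- A homomorphism out of a flat module stays injective after tensoring with any module if it does
so after tensoring with the injective modules. -/
theorem IsFlat.map_injective_of_injective (hM : IsFlat R M) {g : M →ₗ[R] N}
    (hg : ∀ (I : Type u) [AddCommGroup I] [Module Rᵐᵒᵖ I], Module.Injective Rᵐᵒᵖ I →
      Injective (BTensor.map (LinearMap.id : I →ₗ[Rᵐᵒᵖ] I) g))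
    (A : Type u) [AddCommGroup A] [Module Rᵐᵒᵖ A] :
    Injective (BTensor.map (LinearMap.id : A →ₗ[Rᵐᵒᵖ] A) g) := by
  obtain ⟨I, f, hI, hf⟩ := exists_injective_embedding Rᵐᵒᵖ A
  -- `A ⊗ M → I ⊗ M → I ⊗ N` is injective and also factors through `A ⊗ N`.
  have h1 : Injective (BTensor.map LinearMap.id g ∘ BTensor.map f LinearMap.id) :=
    (hg I hI).comp (hM A I f hf)
  have h2 : BTensor.map LinearMap.id g ∘ BTensor.map f LinearMap.id =
      BTensor.map f LinearMap.id ∘ BTensor.map LinearMap.id g :=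
    funext fun x => (BTensor.map_comm f g x).symm
  rw [h2] at h1
  exact h1.of_comp

end Flat

/-! ### Exact sequences of abelian groups, in a form usable before and after tensoring. -/

section ExactSeq

variable {n : ℕ} {X Y Z : ℕ → Type u} [∀ i, AddCommGroup (X i)] [∀ i, AddCommGroup (Y i)]
  [∀ i, AddCommGroup (Z i)] {dX : ∀ i, X (i + 1) →+ X i} {dY : ∀ i, Y (i + 1) →+ Y i}
  {dZ : ∀ i, Z (i + 1) →+ Z i}

/-- A direct sum of two exact sequences is exact. -/
theorem IsExactSeq.directSum (hX : IsExactSeq n X dX) (hZ : IsExactSeq n Z dZ)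
    (a : ∀ i, X i →+ Y i) (p : ∀ i, Y i →+ X i) (b : ∀ i, Z i →+ Y i) (q : ∀ i, Y i →+ Z i)
    (ha : ∀ i x, dY i (a (i + 1) x) = a i (dX i x))
    (hp : ∀ i y, p i (dY i y) = dX i (p (i + 1) y))
    (hb : ∀ i z, dY i (b (i + 1) z) = b i (dZ i z))
    (hq : ∀ i y, q i (dY i y) = dZ i (q (i + 1) y))
    (h : ∀ i y, a i (p i y) + b i (q i y) = y) : IsExactSeq n Y dY := by
  obtain ⟨hX1, hX2, hX3⟩ := hX
  obtain ⟨hZ1, hZ2, hZ3⟩ := hZ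
  refine ⟨(injective_iff_map_eq_zero _).2 fun y hy => ?_, fun i hi y => ⟨fun hy => ?_, ?_⟩,
    fun y => ?_⟩
  · have h1 : p (n + 1) y = 0 := (injective_iff_map_eq_zero _).1 hX1 _ (by
      rw [← hp, hy, map_zero])
    have h2 : q (n + 1) y = 0 := (injective_iff_map_eq_zero _).1 hZ1 _ (by
      rw [← hq, hy, map_zero])
    rw [← h _ y, h1, h2, map_zero, map_zero, add_zero]
  · obtain ⟨x, hx⟩ := (hX2 i hi (p _ y)).1 (by rw [← hp, hy, map_zero])
    obtain ⟨z, hz⟩ := (hZ2 i hi (q _ y)).1 (by rw [← hq, hy, map_zero])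
    exact ⟨a _ x + b _ z, by rw [map_add, ha, hb, hx, hz, h]⟩
  · rintro ⟨y, rfl⟩
    rw [← h _ (dY i (dY (i + 1) y)), hp, hq, hp, hq, (hX2 i hi).apply_apply_eq_zero,
      (hZ2 i hi).apply_apply_eq_zero, map_zero, map_zero, add_zero]
  · obtain ⟨x, hx⟩ := hX3 (p _ y)
    obtain ⟨z, hz⟩ := hZ3 (q _ y)
    exact ⟨a _ x + b _ z, by rw [map_add, ha, hb, hx, hz, h]⟩

/-- A contractible sequence is exact. -/
theorem IsExactSeq.of_homotopy (s : ∀ i, X i →+ X (i + 1))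
    (hd : ∀ i x, dX i (dX (i + 1) x) = 0)
    (h0 : ∀ x, dX 0 (s 0 x) = x)
    (h : ∀ i x, dX (i + 1) (s (i + 1) x) + s i (dX i x) = x)
    (hn : ∀ x, s n (dX n x) = x) : IsExactSeq n X dX := by
  refine ⟨LeftInverse.injective hn, fun i _ x => ⟨fun hx => ⟨s _ x, ?_⟩, ?_⟩, fun x => ⟨_, h0 x⟩⟩
  · conv_rhs => rw [← h i x, hx, map_zero, add_zero]
  · rintro ⟨y, rfl⟩
    exact hd i y

/-- The quotient of an exact sequence by a subsequence concentrated in the two leftmost degrees,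
on which the differential is surjective. -/
theorem IsExactSeq.quotient {G : Type*} [AddCommGroup G] (hX : IsExactSeq n X dX)
    (f : ∀ i, G →+ X i) (q : ∀ i, X i →+ Y i) (hfq : ∀ i, Exact (f i) (q i))
    (hq : ∀ i, Surjective (q i)) (hd : ∀ i x, q i (dX i x) = dY i (q (i + 1) x))
    (hf : ∀ g, dX n (f (n + 1) g) = f n g) (hf0 : ∀ i < n, ∀ g, f i g = 0) :
    IsExactSeq n Y dY := by
  obtain ⟨hX1, hX2, hX3⟩ := hX
  refine ⟨(injective_iff_map_eq_zero _).2 fun y hy => ?_, fun i hi y => ?_, fun y => ?_⟩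
  · obtain ⟨x, rfl⟩ := hq _ y
    rw [← hd] at hy
    obtain ⟨g, hg⟩ := (hfq _ _).1 hy
    -- In degree `n` the subsequence is the image of degree `n + 1`, so injectivity of `dX n` puts
    -- `x` in the subsequence.
    rw [← hf] at hg
    rw [← hX1 hg, (hfq _).apply_apply_eq_zero]
  · obtain ⟨x, rfl⟩ := hq _ y
    constructor
    · intro hy
      rw [← hd] at hy
      obtain ⟨g, hg⟩ := (hfq _ _).1 hy
      rw [hf0 i hi] at hg
      obtain ⟨z, rfl⟩ := (hX2 i hi x).1 hg.symm
      exact ⟨q _ z, (hd _ _).symm⟩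
    · rintro ⟨z, hz⟩
      obtain ⟨z, rfl⟩ := hq _ z
      rw [← hz, ← hd, ← hd, (hX2 i hi).apply_apply_eq_zero, map_zero]
  · obtain ⟨x, rfl⟩ := hq _ y
    obtain ⟨z, rfl⟩ := hX3 x
    exact ⟨q _ z, (hd _ _).symm⟩

/-- A subsequence of an exact sequence that differs from it in the two rightmost degrees only,
where it is a preimage. -/
theorem IsExactSeq.subsequence (hX : IsExactSeq n X dX) (j : ∀ i, Y i →+ X i)
    (hj : ∀ i, Injective (j i)) (hd : ∀ i y, j i (dY i y) = dX i (j (i + 1) y))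
    (h1 : ∀ x y, dX 0 x = j 0 y → ∃ z, j 1 z = x) (h2 : ∀ i, Surjective (j (i + 2))) :
    IsExactSeq n Y dY := by
  obtain ⟨hX1, hX2, hX3⟩ := hX
  refine ⟨(injective_iff_map_eq_zero _).2 fun y hy => ?_, fun i hi y => ⟨fun hy => ?_, ?_⟩,
    fun y => ?_⟩
  · refine (injective_iff_map_eq_zero _).1 (hj _) _ ((injective_iff_map_eq_zero _).1 hX1 _ ?_)
    rw [← hd, hy, map_zero]
  · obtain ⟨x, hx⟩ := (hX2 i hi (j _ y)).1 (by rw [← hd, hy, map_zero])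
    obtain ⟨z, rfl⟩ := h2 _ x
    exact ⟨z, hj _ (by rw [hd, hx])⟩
  · rintro ⟨z, rfl⟩
    exact hj _ (by rw [hd, hd, (hX2 i hi).apply_apply_eq_zero, map_zero])
  · obtain ⟨x, hx⟩ := hX3 (j 0 y)
    obtain ⟨z, rfl⟩ := h1 x y hx
    exact ⟨z, hj _ (by rw [hd, hx])⟩

end ExactSeq

/-- There is an exact sequence `0 → A → F_{n-1} → ⋯ → F_0 → B → 0` with all `F_i` flat, which stays
exact under `I ⊗_R -` for every injective right module `I`. -/
def HasFlatSeq (R : Type u) [Ring R] (n : ℕ) (A B : Type u) [AddCommGroup A] [Module R A]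
    [AddCommGroup B] [Module R B] : Prop :=
  ∃ (X : ℕ → ModuleCat.{u} R) (d : ∀ i, X (i + 1) →ₗ[R] X i),
    Nonempty (X 0 ≃ₗ[R] B) ∧ Nonempty (X (n + 1) ≃ₗ[R] A) ∧
    (∀ i < n, IsFlat R (X (i + 1))) ∧
    IsExactSeq n (fun i => X i) (fun i => (d i).toAddMonoidHom) ∧
    ∀ (I : Type u) [AddCommGroup I] [Module Rᵐᵒᵖ I], Module.Injective Rᵐᵒᵖ I →
      IsExactSeq n (fun i => BTensor R I (X i))
        (fun i => BTensor.map (LinearMap.id : I →ₗ[Rᵐᵒᵖ] I) (d i))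

theorem isNSGFlat_iff_hasFlatSeq {R : Type u} [Ring R] {n : ℕ} {M : Type u} [AddCommGroup M]
    [Module R M] : IsNSGFlat R n M ↔ HasFlatSeq R n M M := Iff.rfl

/-! ### Cancelling and adding flat modules at the ends. -/

section FlatSeq

variable {R : Type u} [Ring R] {n : ℕ} {A B F : Type u} [AddCommGroup A] [Module R A]
  [AddCommGroup B] [Module R B] [AddCommGroup F] [Module R F]

theorem HasFlatSeq.of_family (Y : ℕ → Type u) [∀ i, AddCommGroup (Y i)] [∀ i, Module R (Y i)]
    (d : ∀ i, Y (i + 1) →ₗ[R] Y i) (e0 : Y 0 ≃ₗ[R] B) (e1 : Y (n + 1) ≃ₗ[R] A)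
    (hY : ∀ i < n, IsFlat R (Y (i + 1)))
    (hd : IsExactSeq n Y (fun i => (d i).toAddMonoidHom))
    (hI : ∀ (I : Type u) [AddCommGroup I] [Module Rᵐᵒᵖ I], Module.Injective Rᵐᵒᵖ I →
      IsExactSeq n (fun i => BTensor R I (Y i))
        (fun i => BTensor.map (LinearMap.id : I →ₗ[Rᵐᵒᵖ] I) (d i))) : HasFlatSeq R n A B :=
  ⟨fun i => ModuleCat.of R (Y i), d, ⟨e0⟩, ⟨e1⟩, hY, hd, hI⟩

/-- A flat module can be cancelled from the left end of a sequence. -/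
theorem HasFlatSeq.cancel_left (hn : 1 ≤ n) (hF : IsFlat R F) (h : HasFlatSeq R n (A × F) B) :
    HasFlatSeq R n A B := by
  obtain ⟨X, d, ⟨e0⟩, ⟨e1⟩, hX, hd, hI⟩ := h
  let φ : F →ₗ[R] X (n + 1) := e1.symm ∘ₗ LinearMap.inr R A F
  -- The ranges of `f` form the subcomplex to divide out: `F` in degree `n + 1`, its image under `d
  -- n` in degree `n`, zero elsewhere.
  let f : ∀ i, F →ₗ[R] X i := Pi.single (n + 1) φ + Pi.single n (d n ∘ₗ φ)
  have f1 : f (n + 1) = φ := by simp [f]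
  have f2 : f n = d n ∘ₗ φ := by simp [f]
  have f0 : ∀ i < n, f i = 0 := fun i hi => by
    simp [f, Pi.single_eq_of_ne hi.ne, Pi.single_eq_of_ne (show i ≠ n + 1 by omega)]
  have fd : ∀ i ≠ n, ∀ x, d i (f (i + 1) x) = 0 := by
    intro i hi x
    by_cases hi' : i + 1 = n
    · subst hi'
      rw [f2]
      exact (hd.2.1 i (by omega)).apply_apply_eq_zero (φ x)
    · simp [f, Pi.single_eq_of_ne hi', Pi.single_eq_of_ne (show i + 1 ≠ n + 1 by omega)]
  have hle : ∀ i, LinearMap.range (f (i + 1)) ≤ (LinearMap.range (f i)).comap (d i) := by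
    rintro i _ ⟨x, rfl⟩
    by_cases hi : i = n
    · subst hi
      exact ⟨x, by rw [f1, f2]; rfl⟩
    · exact ⟨0, by rw [map_zero, fd i hi]⟩
  have hex : ∀ i, Exact (f i) (LinearMap.range (f i)).mkQ := fun i =>
    LinearMap.exact_map_mkQ_range (f i)
  have hsurj : ∀ i, Surjective (LinearMap.range (f i)).mkQ := fun i => Submodule.mkQ_surjective _
  have hcomm : ∀ i, (LinearMap.range (f i)).mkQ ∘ₗ d i =
      Submodule.mapQ _ _ (d i) (hle i) ∘ₗ (LinearMap.range (f (i + 1))).mkQ := fun i => rfl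
  have hφ : (LinearMap.snd R A F ∘ₗ e1.toLinearMap) ∘ₗ φ = LinearMap.id := by
    ext x; simp [φ]
  have hker : LinearMap.range (f (n + 1)) = LinearMap.ker (LinearMap.fst R A F ∘ₗ e1.toLinearMap) := by
    rw [f1]
    ext x
    constructor
    · rintro ⟨y, rfl⟩
      simp [φ]
    · intro hx
      have hx' : (e1 x).1 = 0 := hx
      refine ⟨(e1 x).2, e1.injective ?_⟩
      simp [φ, Prod.ext_iff, hx']
  refine HasFlatSeq.of_family (fun i => X i ⧸ LinearMap.range (f i))
    (fun i => Submodule.mapQ _ _ (d i) (hle i)) ?_ ?_ ?_ ?_ ?_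
  -- Since `n ≥ 1`, degree `0` is untouched.
  · exact (Submodule.quotEquivOfEqBot _ (by rw [f0 0 hn, LinearMap.range_zero])).trans e0
  · exact (Submodule.quotEquivOfEq _ _ hker).trans (LinearMap.quotKerEquivOfSurjective _
      (Prod.fst_surjective.comp e1.surjective))
  · intro i hi
    by_cases hi' : i + 1 = n
    -- The only flat term that changes. After tensoring with an injective `I`, the map from `F` is a
    -- split inclusion followed by the injective `I ⊗ d n`, so `F` is pure in this term.
    · subst hi'
      refine (hX i hi).cokernel (g := f (i + 1)) ?_ (hex _) (hsurj _)
      refine fun A _ _ => hF.map_injective_of_injective (fun I _ _ hII => ?_) A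
      have h1 : Injective (BTensor.map LinearMap.id (d (i + 1)) ∘
          BTensor.map (LinearMap.id : I →ₗ[Rᵐᵒᵖ] I) φ) :=
        (hI I hII).1.comp (BTensor.map_injective_of_retraction hφ)
      intro x y hxy
      apply h1
      simpa only [comp_apply, BTensor.map_id_map_id, f2] using hxy
    · exact (hX i hi).of_equiv (Submodule.quotEquivOfEqBot _ (by
        rw [f0 (i + 1) (by omega), LinearMap.range_zero])).symm
  · exact hd.quotient (fun i => (f i).toAddMonoidHom)
      (fun i => (LinearMap.range (f i)).mkQ.toAddMonoidHom) hex hsurj (fun i x => rfl)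
      (fun g => by
        change d n (f (n + 1) g) = f n g
        rw [f1, f2]; rfl)
      (fun i hi g => by
        change f i g = 0
        rw [f0 i hi]; rfl)
  · intro I _ _ hII
    refine (hI I hII).quotient (fun i => BTensor.map LinearMap.id (f i))
      (fun i => BTensor.map LinearMap.id (LinearMap.range (f i)).mkQ)
      (fun i => BTensor.exact_map_right (hex i) (hsurj i))
      (fun i => BTensor.map_surjective surjective_id (hsurj i)) (fun i x => ?_) (fun g => ?_)
      (fun i hi g => ?_)
    · rw [BTensor.map_id_map_id, BTensor.map_id_map_id, hcomm]
    · rw [BTensor.map_id_map_id, f1, f2]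
    · rw [f0 i hi, BTensor.map_zero_right]

/-- A flat module can be cancelled from the right end of a sequence. -/
theorem HasFlatSeq.cancel_right (hn : 1 ≤ n) (hF : IsFlat R F) (h : HasFlatSeq R n A (B × F)) :
    HasFlatSeq R n A B := by
  obtain ⟨X, d, ⟨e0⟩, ⟨e1⟩, hX, hd, hI⟩ := h
  let π : X 0 →ₗ[R] F := LinearMap.snd R B F ∘ₗ e0.toLinearMap
  have hπ : Surjective π := Prod.snd_surjective.comp e0.surjective
  have hd0 : Surjective (d 0) := hd.2.2
  have hπd : Surjective (π ∘ₗ d 0) := hπ.comp hd0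
  -- `K 0` is a copy of `B`, and `K 1` is its preimage under `d 0`.
  let K : ∀ i, Submodule R (X i) := fun i => match i with
    | 0 => LinearMap.ker π
    | 1 => LinearMap.ker (π ∘ₗ d 0)
    | _ + 2 => ⊤
  have hle : ∀ i, ∀ x ∈ K (i + 1), d i x ∈ K i := by
    intro i x hx
    match i with
    | 0 => exact hx
    | 1 =>
      change π (d 0 (d 1 x)) = 0
      have h0 : d 0 (d 1 x) = 0 := (hd.2.1 0 hn).apply_apply_eq_zero x
      rw [h0, map_zero]
    | _ + 2 => trivial
  have hex0 : Exact (K 0).subtype π := LinearMap.exact_subtype_ker_map π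
  have hex1 : Exact (K 1).subtype (π ∘ₗ d 0) := LinearMap.exact_subtype_ker_map _
  have htop : ∀ i, (K (i + 2)).subtype ∘ₗ (LinearMap.id.codRestrict (K (i + 2)) fun _ => trivial) =
      LinearMap.id := fun i => rfl
  let e : K 0 ≃ₗ[R] B := LinearEquiv.ofBijective
    (LinearMap.fst R B F ∘ₗ e0.toLinearMap ∘ₗ (K 0).subtype) (by
      constructor
      · refine (injective_iff_map_eq_zero _).2 fun x hx => ?_
        have h1 : (e0 x).1 = 0 := hx
        have h2 : (e0 x).2 = 0 := x.2
        exact Subtype.ext (e0.injective (by rw [Prod.ext_iff]; simp [h1, h2]))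
      · intro b
        exact ⟨⟨e0.symm (b, 0), show (e0 (e0.symm (b, 0))).2 = 0 by simp⟩,
          show (e0 (e0.symm (b, 0))).1 = b by simp⟩)
  refine HasFlatSeq.of_family (fun i => K i) (fun i => (d i).restrict (hle i)) e ?_ ?_ ?_ ?_
  · refine (LinearEquiv.ofTop (K (n + 1)) ?_).trans e1
    -- Since `n ≥ 1`, the left end falls in the branch where `K` is everything.
    obtain ⟨m, rfl⟩ : ∃ m, n = m + 1 := ⟨n - 1, by omega⟩
    rfl
  · intro i hi
    match i with
    | 0 => exact (hX 0 hi).kernel hF (K 1).subtype_injective hex1 hπd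
    | j + 1 => exact (hX (j + 1) hi).of_equiv (LinearEquiv.ofTop (K (j + 2)) rfl).symm
  · exact hd.subsequence (fun i => (K i).subtype.toAddMonoidHom)
      (fun i => (K i).subtype_injective) (fun _ _ => rfl)
      (fun x y hxy => ⟨⟨x, show d 0 x ∈ K 0 from (show d 0 x = y from hxy) ▸ y.2⟩, rfl⟩)
      (fun i x => ⟨⟨x, trivial⟩, rfl⟩)
  · intro I _ _ hII
    refine (hI I hII).subsequence (fun i => BTensor.map LinearMap.id (K i).subtype)
      (fun i => ?_) (fun i y => ?_) (fun x y hxy => ?_) (fun i x => ?_)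
    · match i with
      | 0 => exact hF.map_injective (K 0).subtype_injective hex0 hπ I
      | 1 => exact hF.map_injective (K 1).subtype_injective hex1 hπd I
      | j + 2 =>
        exact BTensor.map_injective_of_retraction
          (g := (K (j + 2)).subtype)
          (p := LinearMap.id.codRestrict (K (j + 2)) fun _ => trivial) rfl
    · rw [BTensor.map_id_map_id, BTensor.map_id_map_id]; rfl
    -- An element whose image comes from `I ⊗ K 0` dies in `I ⊗ F`; right exactness then places it
    -- in the image of `I ⊗ K 1`.
    · refine (BTensor.exact_map_right hex1 hπd x).1 ?_
      rw [← BTensor.map_id_map_id, hxy, (BTensor.exact_map_right hex0 hπ).apply_apply_eq_zero]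
    · exact ⟨BTensor.map LinearMap.id (LinearMap.id.codRestrict (K (i + 2)) fun _ => trivial) x, by
        rw [BTensor.map_id_map_id, htop, BTensor.map_id_id]⟩

/-- The submodule `F` in the degrees `1, …, n + 1`, and `0` elsewhere. -/
def stage (R : Type u) [Ring R] (F : Type u) [AddCommGroup F] [Module R F] (n i : ℕ) :
    Submodule R F :=
  if 1 ≤ i ∧ i ≤ n + 1 then ⊤ else ⊥

theorem stage_eq_top {i : ℕ} (h1 : 1 ≤ i) (h2 : i ≤ n + 1) : stage R F n i = ⊤ :=
  if_pos ⟨h1, h2⟩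

theorem stage_zero : stage R F n 0 = ⊥ := if_neg (by omega)

theorem stage_last : stage R F n (n + 2) = ⊥ := if_neg (by omega)

/-- The `i`-th term of the contractible sequence `0 → F → F² → ⋯ → F² → F → 0`. -/
abbrev ContractibleTerm (R : Type u) [Ring R] (F : Type u) [AddCommGroup F] [Module R F]
    (n i : ℕ) : Type u :=
  stage R F n (i + 1) × stage R F n i

/-- The differential `(x, y) ↦ (y, 0)`. -/
def contractibleD (R : Type u) [Ring R] (F : Type u) [AddCommGroup F] [Module R F] (n i : ℕ) :
    ContractibleTerm R F n (i + 1) →ₗ[R] ContractibleTerm R F n i :=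
  LinearMap.inl R _ _ ∘ₗ LinearMap.snd R _ _

/-- The contracting homotopy `(x, y) ↦ (0, x)`. -/
def contractibleH (R : Type u) [Ring R] (F : Type u) [AddCommGroup F] [Module R F] (n i : ℕ) :
    ContractibleTerm R F n i →ₗ[R] ContractibleTerm R F n (i + 1) :=
  LinearMap.inr R _ _ ∘ₗ LinearMap.fst R _ _

theorem contractibleD_comp_self (i : ℕ) :
    contractibleD R F n i ∘ₗ contractibleD R F n (i + 1) = 0 := by
  ext <;> simp [contractibleD]

/-- The composite is `(x, y) ↦ (x, 0)`, and `y` lives in stage `0`, which is zero. At the other end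
the vanishing of stage `n + 2` plays the same role. -/
theorem contractibleD_comp_H_zero :
    contractibleD R F n 0 ∘ₗ contractibleH R F n 0 = LinearMap.id := by
  refine LinearMap.ext fun ⟨x, y⟩ => ?_
  have hy : y = 0 := Subtype.ext ((Submodule.mem_bot R).1 (stage_zero (R := R) (F := F) (n := n) ▸ y.2))
  simp [contractibleD, contractibleH, hy]

theorem contractibleH_comp_D_last :
    contractibleH R F n n ∘ₗ contractibleD R F n n = LinearMap.id := by
  refine LinearMap.ext fun ⟨x, y⟩ => ?_
  have hx : x = 0 := Subtype.ext ((Submodule.mem_bot R).1 (stage_last (R := R) (F := F) (n := n) ▸ x.2))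
  simp [contractibleD, contractibleH, hx]

theorem contractible_homotopy (i : ℕ) :
    contractibleD R F n (i + 1) ∘ₗ contractibleH R F n (i + 1) +
      contractibleH R F n i ∘ₗ contractibleD R F n i = LinearMap.id := by
  refine LinearMap.ext fun ⟨x, y⟩ => ?_
  simp [contractibleD, contractibleH]

theorem isExactSeq_contractible :
    IsExactSeq n (ContractibleTerm R F n) (fun i => (contractibleD R F n i).toAddMonoidHom) :=
  .of_homotopy (fun i => (contractibleH R F n i).toAddMonoidHom)
    (fun i => LinearMap.congr_fun (contractibleD_comp_self i))
    (LinearMap.congr_fun contractibleD_comp_H_zero)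
    (fun i => LinearMap.congr_fun (contractible_homotopy i))
    (LinearMap.congr_fun contractibleH_comp_D_last)

/-- Additive functors preserve contracting homotopies, so `I` may be arbitrary. -/
theorem isExactSeq_tensor_contractible (I : Type u) [AddCommGroup I] [Module Rᵐᵒᵖ I] :
    IsExactSeq n (fun i => BTensor R I (ContractibleTerm R F n i))
      (fun i => BTensor.map (LinearMap.id : I →ₗ[Rᵐᵒᵖ] I) (contractibleD R F n i)) := by
  refine .of_homotopy (fun i => BTensor.map LinearMap.id (contractibleH R F n i))
    (fun i x => ?_) (fun x => ?_) (fun i x => ?_) (fun x => ?_)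
  · rw [BTensor.map_id_map_id, contractibleD_comp_self, BTensor.map_zero_right]
  · rw [BTensor.map_id_map_id, contractibleD_comp_H_zero, BTensor.map_id_id]
  · rw [BTensor.map_id_map_id, BTensor.map_id_map_id, ← BTensor.map_add_right,
      contractible_homotopy, BTensor.map_id_id]
  · rw [BTensor.map_id_map_id, contractibleH_comp_D_last, BTensor.map_id_id]

/-- A flat module can be added to both ends of a sequence. -/
theorem HasFlatSeq.prod (hF : IsFlat R F) (h : HasFlatSeq R n A B) :
    HasFlatSeq R n (A × F) (B × F) := by
  obtain ⟨X, d, ⟨e0⟩, ⟨e1⟩, hX, hd, hI⟩ := h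
  let Y : ℕ → Type u := fun i => X i × ContractibleTerm R F n i
  let dY : ∀ i, Y (i + 1) →ₗ[R] Y i := fun i => (d i).prodMap (contractibleD R F n i)
  have hsum : ∀ i, LinearMap.inl R (X i) (ContractibleTerm R F n i) ∘ₗ LinearMap.fst R _ _ +
      LinearMap.inr R _ _ ∘ₗ LinearMap.snd R _ _ = LinearMap.id := fun i => by
    refine LinearMap.ext fun x => ?_
    simp
  have ha : ∀ i, dY i ∘ₗ LinearMap.inl R _ _ = LinearMap.inl R _ _ ∘ₗ d i := fun i =>
    LinearMap.ext fun x => Prod.ext rfl (map_zero (contractibleD R F n i))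
  have hb : ∀ i, dY i ∘ₗ LinearMap.inr R _ _ = LinearMap.inr R _ _ ∘ₗ contractibleD R F n i :=
    fun i => LinearMap.ext fun x => Prod.ext (map_zero (d i)) rfl
  have hp : ∀ i, LinearMap.fst R _ _ ∘ₗ dY i = d i ∘ₗ LinearMap.fst R _ _ := fun i => rfl
  have hq : ∀ i, LinearMap.snd R _ _ ∘ₗ dY i = contractibleD R F n i ∘ₗ LinearMap.snd R _ _ :=
    fun i => rfl
  have htop : ∀ i, 1 ≤ i → i ≤ n + 1 → Nonempty (stage R F n i ≃ₗ[R] F) := fun i h1 h2 =>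
    ⟨LinearEquiv.ofTop _ (stage_eq_top h1 h2)⟩
  have hbot0 : Subsingleton (stage R F n 0) := by rw [stage_zero]; infer_instance
  have hbot1 : Subsingleton (stage R F n (n + 2)) := by rw [stage_last]; infer_instance
  have hu0 : Unique (stage R F n 0) := uniqueOfSubsingleton 0
  have hu1 : Unique (stage R F n (n + 1 + 1)) := @uniqueOfSubsingleton _ hbot1 0
  obtain ⟨t0⟩ := htop 1 le_rfl (by omega)
  obtain ⟨t1⟩ := htop (n + 1) (by omega) le_rfl
  refine HasFlatSeq.of_family Y dY (e0.prodCongr (LinearEquiv.prodUnique.trans t0))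
    (e1.prodCongr (LinearEquiv.uniqueProd.trans t1)) ?_ ?_ ?_
  · intro i hi
    obtain ⟨s⟩ := htop (i + 1) (by omega) (by omega)
    obtain ⟨t⟩ := htop (i + 1 + 1) (by omega) (by omega)
    exact (hX i hi).prod ((hF.of_equiv t.symm).prod (hF.of_equiv s.symm))
  · exact hd.directSum isExactSeq_contractible
      (fun i => (LinearMap.inl R _ _).toAddMonoidHom) (fun i => (LinearMap.fst R _ _).toAddMonoidHom)
      (fun i => (LinearMap.inr R _ _).toAddMonoidHom) (fun i => (LinearMap.snd R _ _).toAddMonoidHom)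
      (fun i => LinearMap.congr_fun (ha i)) (fun i => LinearMap.congr_fun (hp i))
      (fun i => LinearMap.congr_fun (hb i)) (fun i => LinearMap.congr_fun (hq i))
      (fun i => LinearMap.congr_fun (hsum i))
  · intro I _ _ hII
    refine (hI I hII).directSum (isExactSeq_tensor_contractible I)
      (fun i => BTensor.map LinearMap.id (LinearMap.inl R _ _))
      (fun i => BTensor.map LinearMap.id (LinearMap.fst R _ _))
      (fun i => BTensor.map LinearMap.id (LinearMap.inr R _ _))
      (fun i => BTensor.map LinearMap.id (LinearMap.snd R _ _))
      (fun i x => ?_) (fun i x => ?_) (fun i x => ?_) (fun i x => ?_) (fun i x => ?_)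
    · rw [BTensor.map_id_map_id, BTensor.map_id_map_id, ha]
    · rw [BTensor.map_id_map_id, BTensor.map_id_map_id, hp]
    · rw [BTensor.map_id_map_id, BTensor.map_id_map_id, hb]
    · rw [BTensor.map_id_map_id, BTensor.map_id_map_id, hq]
    · rw [BTensor.map_id_map_id, BTensor.map_id_map_id, ← BTensor.map_add_right, hsum,
        BTensor.map_id_id]

/-- Cancellation passes through a sequence with left end `A` and right end `A × F`. -/
theorem isNSGFlat_prod_iff (hn : 1 ≤ n) (hF : IsFlat R F) :
    IsNSGFlat R n (A × F) ↔ IsNSGFlat R n A := by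
  simp only [isNSGFlat_iff_hasFlatSeq]
  exact ⟨fun h => (h.cancel_left hn hF).cancel_right hn hF, fun h => h.prod hF⟩

theorem IsNSGFlat.of_equiv (e : A ≃ₗ[R] B) (h : IsNSGFlat R n A) : IsNSGFlat R n B := by
  obtain ⟨X, d, ⟨e0⟩, ⟨e1⟩, h⟩ := h
  exact ⟨X, d, ⟨e0.trans e⟩, ⟨e1.trans e⟩, h⟩

theorem isNSGFlat_congr (e : A ≃ₗ[R] B) : IsNSGFlat R n A ↔ IsNSGFlat R n B :=
  ⟨.of_equiv e, .of_equiv e.symm⟩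

end FlatSeq

end SGFlat

end

/-! ### Reduction of both statements to adding or cancelling one flat summand. -/

theorem theorem4p5 (R : Type u) [Ring R] (n : ℕ) (hn : 1 ≤ n) :
    (∀ (M : Type u) [AddCommGroup M] [Module R M] (N : Submodule R M),
      SGFlat.IsFlatFreePart N → (SGFlat.IsNSGFlat R n M ↔ SGFlat.IsNSGFlat R n N)) ∧
    (∀ (M N : Type u) [AddCommGroup M] [Module R M] [AddCommGroup N] [Module R N],
      SGFlat.FlatlyEquivalent R M N → (SGFlat.IsNSGFlat R n M ↔ SGFlat.IsNSGFlat R n N)) := by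
  constructor
  · rintro M _ _ N ⟨⟨F, hNF, hF⟩, -⟩
    rw [← SGFlat.isNSGFlat_prod_iff (A := N) hn hF]
    exact SGFlat.isNSGFlat_congr (Submodule.prodEquivOfIsCompl N F hNF).symm
  · rintro M N _ _ _ _ ⟨F₁, F₂, h₁, h₂, ⟨e⟩⟩
    rw [← SGFlat.isNSGFlat_prod_iff (A := M) hn h₁, ← SGFlat.isNSGFlat_prod_iff (A := N) hn h₂]
    exact SGFlat.isNSGFlat_congr e
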